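/- For graphs $H,F$, let $\mathrm{ex}(n,H,F)$ denote the maximum number of copies of $H$ (subgraphs isomorphic to $H$) in an $n$-vertex graph that contains no copy of $F$ as a (not necessarily induced) subgraph. Let $S_\ell=K_{1,\ell}$ be the star with $\ell$ edges, and let $\bigcup_{i=1}^k S_{d_i}$ be the union of $k$ vertex-disjoint stars. Let $k\ge 2$, $d_1\ge d_2\ge\cdots\ge d_k\ge 2$ and $1\le r\le d_1+k-2$ be integers. Then for all sufficiently large $n$ (depending on $k$, $r$ and the $d_i$), $$ \mathrm{ex}\Big(n,K_r,\bigcup_{i=1}^k S_{d_i}\Big)\le \max\Bigg\{\max_{1\le i\le k}\bigg\{\bigg(\binom{d_i+i-1}{r}-\binom{i-1}{r}\bigg)\left\lceil\frac{n-i+1}{d_i}\right\rceil+\binom{i-1}{r}\bigg\},\ \max_{\substack{1\le i\le k\\ i<r+1}}\bigg\{\frac{d_i-1}{r-i+1}(n-i+1)\bigg\},\ \max_{\substack{1\le c<k-1\\ c<r}}\bigg\{\frac{\max\big\{\binom{d_c+c}{r-1},\,d_c+c\big\}}{r-c}(n-c)\bigg\}\Bigg\}, $$ where the third maximum is omitted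 when its index range is empty. (The conditions $i<r+1$ and $c<r$ say that the denominators are positive; for large $n$ the terms with a negative denominator are negative and would not affect the maximum.) -/

import Mathlib

/-- The star `S_ℓ = K_{1,ℓ}` with `ℓ` edges; its centre is the vertex `0`. -/
def starS (ℓ : ℕ) : SimpleGraph (Fin (ℓ + 1)) :=
  SimpleGraph.starGraph 0

/-- The star forest `S_{d 1} ∪ ⋯ ∪ S_{d k}`, a union of `k` vertex-disjoint stars. -/
def starForest (k : ℕ) (d : ℕ → ℕ) :
    SimpleGraph (Σ i : Finset.Icc 1 k, Fin (d i + 1)) :=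
  ⨆ i : Finset.Icc 1 k,
    (starS (d i)).map (Function.Embedding.sigmaMk (β := fun j : Finset.Icc 1 k => Fin (d j + 1)) i)

open scoped Classical in
/-- The generalized Turán number `ex(n, H, F)`: the maximum number of copies of `H` (subgraphs
isomorphic to `H`) in an `F`-free graph on `n` vertices. -/
noncomputable def generalizedTuran (n : ℕ) {V W : Type*} (H : SimpleGraph V) (F : SimpleGraph W) :
    ℕ :=
  Finset.sup {G : SimpleGraph (Fin n) | F.Free G} (fun G => G.copyCount H)

/-- `(C(d_i+i-1, r) - C(i-1, r)) ⌈(n-i+1)/d_i⌉ + C(i-1, r)`, for `i ≥ 1`. -/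
noncomputable def cliqueTerm (d : ℕ → ℕ) (r n i : ℕ) : ℝ :=
  (((d i + i - 1).choose r : ℝ) - ((i - 1).choose r : ℝ)) * (⌈((n : ℝ) - i + 1) / d i⌉ : ℝ)
    + ((i - 1).choose r : ℝ)

/-- `(d_i-1)/(r-i+1) · (n-i+1)`. -/
noncomputable def regularTerm (d : ℕ → ℕ) (r n i : ℕ) : ℝ :=
  ((d i : ℝ) - 1) / ((r : ℝ) - i + 1) * ((n : ℝ) - i + 1)

/-- `max {C(d_c+c, r-1), d_c+c} / (r-c) · (n-c)`, for `r ≥ 1`. -/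
noncomputable def degreeTerm (d : ℕ → ℕ) (r n c : ℕ) : ℝ :=
  ((max ((d c + c).choose (r - 1)) (d c + c) : ℕ) : ℝ) / ((r : ℝ) - c) * ((n : ℝ) - c)

open scoped Classical in
/-- All the values over which the three-part maximum is taken. The fractions are listed for those
indices for which their denominators `r-i+1` and `r-c` are positive. -/
noncomputable def boundTerms (k : ℕ) (d : ℕ → ℕ) (r n : ℕ) : Finset ℝ :=
  (Finset.Icc 1 k).image (cliqueTerm d r n) ∪
    {i ∈ Finset.Icc 1 k | i < r + 1}.image (regularTerm d r n) ∪
    {c ∈ Finset.Ico 1 (k - 1) | c < r}.image (degreeTerm d r n)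

theorem boundTerms_nonempty {k : ℕ} (hk : 2 ≤ k) (d : ℕ → ℕ) (r n : ℕ) :
    (boundTerms k d r n).Nonempty := by
  refine ⟨cliqueTerm d r n 1, ?_⟩
  simp only [boundTerms, Finset.mem_union, Finset.mem_image]
  exact Or.inl (Or.inl ⟨1, Finset.mem_Icc.2 ⟨le_refl 1, by omega⟩, rfl⟩)

/-! Let `C` be the set of vertices of degree at least `D = k + ∑ d i`, and `c` its size. Stars
centred in `C` can always be completed last, so `c < k` in a free graph (`card_lt_of_free`). Sharing
each clique not inside `C` equally among its vertices outside `C` bounds the count by `c.choose r`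
plus the sum of the weights `cliqueWeight c r (outDegree G C x)` (`card_cliqueFinset_le`).

If all outdegrees are below `d (c + 1)`, this is at most the clique term of index `c + 1`. Otherwise
some vertex carries star `c + 1`. Then `c + 2 ≤ k` and only boundedly many vertices have outdegree
at least `d (c + 2)`, since far-apart ones would carry the remaining stars
(`isContained_of_outDegree`). The count is at most `cliqueWeight c r (d (c + 2) - 1) * n + O(1)`.
For `r ≥ 2` this slope is either strictly below that of the clique term of index `c + 2`, or zero,
and then the regular term of index 1 wins (`exists_term_eventually_ge`). The third family of terms
is never needed. -/

namespace StarForest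

/-! ### Embedding star forests. -/

variable {V : Type*}

/-- The vertices `v i` for `i ∈ I` are distinct, and for the indices `i ∈ T` the sets `L i` consist
of `d i` neighbours of `v i`, are pairwise disjoint, and avoid all the vertices `v j`, `j ∈ I`. -/
structure IsStarPacking (G : SimpleGraph V) (d : ℕ → ℕ) (I T : Finset ℕ) (v : ℕ → V)
    (L : ℕ → Finset V) : Prop where
  injOn : Set.InjOn v I
  card_eq : ∀ i ∈ T, (L i).card = d i
  adj : ∀ i ∈ T, ∀ x ∈ L i, G.Adj (v i) x
  notMem : ∀ i ∈ T, ∀ j ∈ I, v j ∉ L i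
  disjoint : ∀ i ∈ T, ∀ j ∈ T, i ≠ j → Disjoint (L i) (L j)

theorem IsStarPacking.isContained {G : SimpleGraph V} {d : ℕ → ℕ} {k : ℕ} {v : ℕ → V}
    {L : ℕ → Finset V} (h : IsStarPacking G d (Finset.Icc 1 k) (Finset.Icc 1 k) v L) :
    (starForest k d).IsContained G := by
  classical
  let e : ∀ i : Finset.Icc 1 k, Fin (d i) ≃ L i := fun i =>
    ((L i).equivFinOfCardEq (h.card_eq i i.2)).symm
  let g : ∀ i : Finset.Icc 1 k, Fin (d i + 1) → V := fun i =>
    Fin.cases (v i) (fun x => (e i x : V))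
  have g0 : ∀ i, g i 0 = v i := fun i => rfl
  have gs : ∀ i x, g i (Fin.succ x) = e i x := fun i x => rfl
  refine ⟨⟨⟨fun p => g p.1 p.2, ?_⟩, ?_⟩⟩
  · intro a b hab
    simp only [starForest, SimpleGraph.iSup_adj, SimpleGraph.map_adj] at hab
    obtain ⟨i, x, y, hxy, rfl, rfl⟩ := hab
    have key : ∀ z : Fin (d i), G.Adj (g i 0) (g i z.succ) := fun z =>
      h.adj i i.2 _ (e i z).2
    rw [starS, SimpleGraph.starGraph_adj] at hxy
    obtain ⟨hne, rfl | rfl⟩ := hxy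
    · obtain ⟨z, rfl⟩ := Fin.exists_succ_eq.2 (Ne.symm hne)
      exact key z
    · obtain ⟨z, rfl⟩ := Fin.exists_succ_eq.2 hne
      exact (key z).symm
  · rintro ⟨i, x⟩ ⟨j, y⟩ hxy
    change g i x = g j y at hxy
    induction x using Fin.cases with
    | zero =>
      induction y using Fin.cases with
      | zero =>
        have : i = j := Subtype.ext (h.injOn (Finset.mem_coe.2 i.2) (Finset.mem_coe.2 j.2) hxy)
        subst this; rfl
      | succ y =>
        rw [g0, gs] at hxy
        exact absurd (hxy ▸ (e j y).2) (h.notMem j j.2 i i.2)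
    | succ x =>
      induction y using Fin.cases with
      | zero =>
        rw [g0, gs] at hxy
        exact absurd (hxy ▸ (e i x).2) (h.notMem i i.2 j j.2)
      | succ y =>
        rw [gs, gs] at hxy
        by_cases hij : i = j
        · subst hij
          have := (e i).injective (Subtype.ext hxy)
          subst this; rfl
        · exact absurd (hxy ▸ (e j y).2) (Finset.disjoint_left.1
            (h.disjoint i i.2 j j.2 (fun h' => hij (Subtype.ext h'))) (e i x).2)

/-- Greedy choice: fewer than `k` earlier vertices block at most `K` each, so `X` is never
exhausted. The prescribed first vertex need not lie in `X`. -/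
theorem exists_separated_seq [DecidableEq V] (near : V → Finset V) {K k a : ℕ} (ha : 1 ≤ a) {X S : Finset V}
    (hXS : X ⊆ S) (hK : ∀ x ∈ S, (near x).card ≤ K) {v₀ : V} (hv₀ : v₀ ∈ S)
    (hX : a < k → k * K < X.card) (b : ℕ) (hab : a ≤ b) :
    b ≤ k → ∃ w : ℕ → V, w a = v₀ ∧ (∀ i ∈ Finset.Ioc a b, w i ∈ X) ∧
      ∀ i j, a ≤ i → i < j → j ≤ b → w j ∉ near (w i) := by
  induction b, hab using Nat.le_induction with
  | base => exact fun _ => ⟨fun _ => v₀, rfl, by simp, fun i j _ _ _ => by omega⟩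
  | succ b hab ih =>
    intro hb
    obtain ⟨w, hwa, hwX, hw⟩ := ih (by omega)
    have hS : ∀ i ∈ Finset.Icc a b, w i ∈ S := by
      intro i hi
      rw [Finset.mem_Icc] at hi
      rcases hi.1.eq_or_lt with rfl | hlt
      · rwa [hwa]
      · exact hXS (hwX i (Finset.mem_Ioc.2 ⟨hlt, hi.2⟩))
    have hU : ((Finset.Icc a b).biUnion fun i => near (w i)).card ≤ k * K := by
      refine (Finset.card_biUnion_le_card_mul _ _ K fun i hi => hK _ (hS i hi)).trans ?_
      rw [Nat.card_Icc]
      exact Nat.mul_le_mul_right _ (by omega)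
    obtain ⟨x, hxX, hx⟩ := Finset.exists_mem_notMem_of_card_lt_card (hU.trans_lt (hX (by omega)))
    simp only [Finset.mem_biUnion, Finset.mem_Icc, not_exists, not_and] at hx
    refine ⟨Function.update w (b + 1) x, ?_, ?_, ?_⟩
    · rw [Function.update_of_ne (by omega), hwa]
    · intro i hi
      rw [Finset.mem_Ioc] at hi
      by_cases hib : i = b + 1
      · subst hib; simpa using hxX
      · rw [Function.update_of_ne hib]
        exact hwX i (Finset.mem_Ioc.2 ⟨hi.1, by omega⟩)
    · intro i j hai hij hjb
      rw [Function.update_of_ne (show i ≠ b + 1 by omega)]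
      by_cases hjb' : j = b + 1
      · subst hjb'; simpa using hx i ⟨hai, by omega⟩
      · rw [Function.update_of_ne hjb']
        exact hw i j hai hij (by omega)

theorem exists_injOn_Icc {C : Finset V} {m : ℕ} (hm : m ≤ C.card) (v₀ : V) :
    ∃ e : ℕ → V, Set.InjOn e (Finset.Icc 1 m) ∧ ∀ i ∈ Finset.Icc 1 m, e i ∈ C := by
  obtain ⟨f⟩ : Nonempty (Finset.Icc 1 m ↪ C) :=
    Function.Embedding.nonempty_of_card_le (by simpa using hm)
  refine ⟨fun i => if h : i ∈ Finset.Icc 1 m then f ⟨i, h⟩ else v₀, ?_, ?_⟩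
  · intro i hi j hj hij
    rw [Finset.mem_coe] at hi hj
    simp only [hi, hj, dif_pos] at hij
    exact congrArg Subtype.val (f.injective (Subtype.ext hij))
  · intro i hi
    simp only [hi, dif_pos]
    exact (f ⟨i, hi⟩).2

variable [Fintype V] [DecidableEq V]

/-- Missing stars are added one at a time: discarding all centres and all used leaves still leaves
`d a` neighbours of the next centre. -/
theorem IsStarPacking.extend {G : SimpleGraph V} [DecidableRel G.Adj] {d : ℕ → ℕ} {I : Finset ℕ}
    {v : ℕ → V} (m : ℕ) : ∀ {T : Finset ℕ} {L : ℕ → Finset V}, T ⊆ I → (I \ T).card = m →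
    (∀ i ∈ I \ T, I.card + ∑ i ∈ I, d i ≤ G.degree (v i)) → IsStarPacking G d I T v L →
    ∃ L', IsStarPacking G d I I v L' := by
  induction m with
  | zero =>
    intro T L hT hm _ h
    have : I = T := (Finset.sdiff_eq_empty_iff_subset.1 (Finset.card_eq_zero.1 hm)).antisymm hT
    subst this
    exact ⟨L, h⟩
  | succ m ih =>
    intro T L hT hm hdeg h
    obtain ⟨a, ha⟩ : (I \ T).Nonempty := Finset.card_pos.1 (by omega)
    have ha' := Finset.mem_sdiff.1 ha
    have hsum : ∑ i ∈ T, d i + d a ≤ ∑ i ∈ I, d i := by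
      rw [add_comm, ← Finset.sum_insert ha'.2]
      exact Finset.sum_le_sum_of_subset (Finset.insert_subset ha'.1 hT)
    have hB : (T.biUnion L).card ≤ ∑ i ∈ T, d i :=
      Finset.card_biUnion_le.trans (Finset.sum_le_sum fun i hi => (h.card_eq i hi).le)
    have hv : (I.image v).card ≤ I.card := Finset.card_image_le
    have hU := Finset.card_union_le (I.image v) (T.biUnion L)
    have hS := Finset.le_card_sdiff (I.image v ∪ T.biUnion L) (G.neighborFinset (v a))
    rw [SimpleGraph.card_neighborFinset_eq_degree] at hS
    have := hdeg a ha
    obtain ⟨M, hM, hMc⟩ := Finset.exists_subset_card_eq (n := d a)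
      (s := G.neighborFinset (v a) \ (I.image v ∪ T.biUnion L)) (by omega)
    have hM' : ∀ x ∈ M, G.Adj (v a) x ∧ (∀ j ∈ I, v j ≠ x) ∧ ∀ j ∈ T, x ∉ L j := by
      intro x hx
      have := hM hx
      simp only [Finset.mem_sdiff, SimpleGraph.mem_neighborFinset, Finset.mem_union,
        Finset.mem_image, Finset.mem_biUnion, not_or, not_exists, not_and] at this
      exact ⟨this.1, this.2.1, this.2.2⟩
    have hne : ∀ i ∈ T, i ≠ a := fun i hi hia => ha'.2 (hia ▸ hi)
    refine ih (T := insert a T) (L := Function.update L a M)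
      (Finset.insert_subset ha'.1 hT) ?_ ?_ ⟨h.injOn, ?_, ?_, ?_, ?_⟩
    · rw [Finset.sdiff_insert, Finset.card_erase_of_mem ha, hm]; rfl
    · intro i hi
      exact hdeg i (Finset.sdiff_subset_sdiff le_rfl (Finset.subset_insert _ _) hi)
    · intro i hi
      rcases Finset.mem_insert.1 hi with rfl | hi
      · simpa using hMc
      · rw [Function.update_of_ne (hne i hi)]; exact h.card_eq i hi
    · intro i hi
      rcases Finset.mem_insert.1 hi with rfl | hi
      · simpa using fun x hx => (hM' x hx).1
      · rw [Function.update_of_ne (hne i hi)]; exact h.adj i hi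
    · intro i hi
      rcases Finset.mem_insert.1 hi with rfl | hi
      · simpa using fun j hj hx => (hM' _ hx).2.1 j hj rfl
      · rw [Function.update_of_ne (hne i hi)]; exact h.notMem i hi
    · intro i hi j hj hij
      rcases Finset.mem_insert.1 hi with rfl | hiT
      · have hj := Finset.mem_of_mem_insert_of_ne hj hij.symm
        rw [Function.update_self, Function.update_of_ne hij.symm, Finset.disjoint_left]
        exact fun x hx => (hM' x hx).2.2 j hj
      · rcases Finset.mem_insert.1 hj with rfl | hjT
        · rw [Function.update_self, Function.update_of_ne hij, Finset.disjoint_right]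
          exact fun x hx => (hM' x hx).2.2 i hiT
        · rw [Function.update_of_ne (hne i hiT), Function.update_of_ne (hne j hjT)]
          exact h.disjoint i hiT j hjT hij

/-- The number of neighbours of `x` outside of `C`. -/
def outDegree (G : SimpleGraph V) [DecidableRel G.Adj] (C : Finset V) (x : V) : ℕ :=
  (G.neighborFinset x \ C).card

theorem outDegree_le_degree (G : SimpleGraph V) [DecidableRel G.Adj] (C : Finset V) (x : V) :
    outDegree G C x ≤ G.degree x :=
  (Finset.card_le_card Finset.sdiff_subset).trans_eq (G.card_neighborFinset_eq_degree x)

theorem card_lt_of_free {G : SimpleGraph V} [DecidableRel G.Adj] {d : ℕ → ℕ} {k : ℕ} (hk : 1 ≤ k)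
    (hG : (starForest k d).Free G) {C : Finset V}
    (hC : ∀ x ∈ C, k + ∑ i ∈ Finset.Icc 1 k, d i ≤ G.degree x) : C.card < k := by
  by_contra! h
  obtain ⟨v₀, _⟩ : C.Nonempty := Finset.card_pos.1 (by omega)
  obtain ⟨e, he, heC⟩ := exists_injOn_Icc h v₀
  obtain ⟨L, hL⟩ := IsStarPacking.extend (G := G) (d := d) (v := e) (I := Finset.Icc 1 k) _
    (L := fun _ => ∅) (Finset.empty_subset _) rfl
    (fun i hi => by simpa using hC _ (heC i (Finset.sdiff_subset hi)))
    ⟨he, by simp, by simp, by simp, by simp⟩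
  exact hG hL.isContained

/-- Star `c + 1` is centred at `v₀` and the later ones at vertices pairwise at distance more than
two outside `C`, so their leaves, taken outside `C`, cannot collide. The first `c` stars, centred in
`C`, are completed last. -/
theorem isContained_of_outDegree {G : SimpleGraph V} [DecidableRel G.Adj] {d : ℕ → ℕ} {k D : ℕ}
    (hD : D = k + ∑ i ∈ Finset.Icc 1 k, d i)
    (hd : ∀ i j : ℕ, 1 ≤ i → i ≤ j → j ≤ k → d j ≤ d i) {C : Finset V} (hCk : C.card < k)
    (hC : ∀ x ∈ C, D ≤ G.degree x) (hC' : ∀ x ∉ C, G.degree x < D)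
    {v₀ : V} (hv₀ : v₀ ∉ C) (hv₀d : d (C.card + 1) ≤ outDegree G C v₀)
    (hX : C.card + 1 < k → k * (1 + (D + D * D)) <
      {x ∈ Cᶜ | d (C.card + 2) ≤ outDegree G C x}.card) :
    (starForest k d).IsContained G := by
  set c := C.card with hc
  let N : V → Finset V := fun x => G.neighborFinset x \ C
  have hN : ∀ x ∉ C, (N x).card ≤ D := fun x hx =>
    (outDegree_le_degree G C x).trans (hC' x hx).le
  have hNC : ∀ x, ∀ y ∈ N x, y ∉ C := fun x y hy => (Finset.mem_sdiff.1 hy).2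
  have hNA : ∀ x, ∀ y ∈ N x, G.Adj x y := fun x y hy => by
    simpa using (Finset.mem_sdiff.1 hy).1
  have hAN : ∀ x y, G.Adj x y → y ∉ C → y ∈ N x := fun x y h hy =>
    Finset.mem_sdiff.2 ⟨by simpa using h, hy⟩
  -- The ball of radius two in `G - C`: avoiding it makes centres distinct, nonadjacent and without
  -- common neighbours outside `C`.
  let near : V → Finset V := fun x => {x} ∪ (N x ∪ (N x).biUnion N)
  have hnear : ∀ x ∈ Cᶜ, (near x).card ≤ 1 + (D + D * D) := by
    intro x hx
    have hx := hN x (by simpa using hx)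
    refine (Finset.card_union_le _ _).trans (add_le_add (by simp) ?_)
    refine (Finset.card_union_le _ _).trans (add_le_add hx ?_)
    exact (Finset.card_biUnion_le_card_mul _ _ D fun y hy => hN y (hNC x y hy)).trans
      (Nat.mul_le_mul_right _ hx)
  obtain ⟨w, hwa, hwX, hw⟩ := exists_separated_seq near (show 1 ≤ c + 1 by omega)
    (Finset.filter_subset _ _) hnear (by simpa using hv₀) hX k hCk le_rfl
  have hwC : ∀ i ∈ Finset.Icc (c + 1) k, w i ∉ C ∧ d i ≤ (N (w i)).card := by
    intro i hi
    rw [Finset.mem_Icc] at hi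
    rcases hi.1.eq_or_lt with rfl | hlt
    · rw [hwa]; exact ⟨hv₀, hv₀d⟩
    · have := Finset.mem_filter.1 (hwX i (Finset.mem_Ioc.2 ⟨hlt, hi.2⟩))
      exact ⟨by simpa using this.1, (hd (c + 2) i (by omega) hlt hi.2).trans this.2⟩
  have hchoice : ∀ i, ∃ L : Finset V, i ∈ Finset.Icc (c + 1) k → L ⊆ N (w i) ∧ L.card = d i := by
    intro i
    by_cases hi : i ∈ Finset.Icc (c + 1) k
    · obtain ⟨L, hL⟩ := Finset.exists_subset_card_eq (hwC i hi).2
      exact ⟨L, fun _ => hL⟩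
    · exact ⟨∅, fun h => absurd h hi⟩
  choose L hL using hchoice
  obtain ⟨e, he, heC⟩ := exists_injOn_Icc hc.le v₀
  have hfar : ∀ i j, c + 1 ≤ i → i < j → j ≤ k →
      w i ≠ w j ∧ ¬ G.Adj (w i) (w j) ∧ Disjoint (N (w i)) (N (w j)) := by
    intro i j hi hij hj
    have h := hw i j hi hij hj
    have hjC := (hwC j (Finset.mem_Icc.2 ⟨by omega, hj⟩)).1
    simp only [near, Finset.mem_union, Finset.mem_singleton, Finset.mem_biUnion, not_or,
      not_exists, not_and] at h
    refine ⟨Ne.symm h.1, fun hadj => h.2.1 (hAN _ _ hadj hjC), Finset.disjoint_left.2 ?_⟩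
    exact fun z hzi hzj => h.2.2 z hzi (hAN _ _ (hNA _ _ hzj).symm hjC)
  let v : ℕ → V := fun i => if i ≤ c then e i else w i
  have hve : ∀ i, i ≤ c → v i = e i := fun i hi => if_pos hi
  have hvw : ∀ i, c + 1 ≤ i → v i = w i := fun i hi => if_neg (by omega)
  have hpack : IsStarPacking G d (Finset.Icc 1 k) (Finset.Icc (c + 1) k) v L := by
    refine ⟨?_, fun i hi => (hL i hi).2, ?_, ?_, ?_⟩
    · have key : ∀ i j, 1 ≤ i → i < j → j ≤ k → v i ≠ v j := by
        intro i j hi hij hj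
        by_cases hjc : j ≤ c
        · rw [hve i (by omega), hve j hjc]
          intro h
          exact hij.ne (he (by simp; omega) (by simp; omega) h)
        · rw [hvw j (by omega)]
          by_cases hic : i ≤ c
          · rw [hve i hic]
            intro h
            exact (hwC j (by simp; omega)).1 (h ▸ heC i (by simp; omega))
          · rw [hvw i (by omega)]
            exact (hfar i j (by omega) hij hj).1
      intro i hi j hj hij
      simp only [Finset.coe_Icc, Set.mem_Icc] at hi hj
      rcases lt_trichotomy i j with h | h | h
      · exact absurd hij (key i j hi.1 h hj.2)
      · exact h
      · exact absurd hij.symm (key j i hj.1 h hi.2)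
    · intro i hi x hx
      rw [hvw i (Finset.mem_Icc.1 hi).1]
      exact hNA _ _ ((hL i hi).1 hx)
    · intro i hi j hj hx
      have hx := (hL i hi).1 hx
      have hi' := Finset.mem_Icc.1 hi
      have hj' := Finset.mem_Icc.1 hj
      by_cases hjc : j ≤ c
      · rw [hve j hjc] at hx
        exact hNC _ _ hx (heC j (by simp; omega))
      · rw [hvw j (by omega)] at hx
        have hadj := hNA _ _ hx
        rcases lt_trichotomy i j with h | rfl | h
        · exact (hfar i j hi'.1 h hj'.2).2.1 hadj
        · exact G.irrefl hadj
        · exact (hfar j i (by omega) h hi'.2).2.1 hadj.symm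
    · intro i hi j hj hij
      refine Disjoint.mono (hL i hi).1 (hL j hj).1 ?_
      rw [Finset.mem_Icc] at hi hj
      rcases Nat.lt_or_gt_of_ne hij with h | h
      · exact (hfar i j hi.1 h hj.2).2.2
      · exact (hfar j i hj.1 h hi.2).2.2.symm
  obtain ⟨L', hL'⟩ := IsStarPacking.extend _ (Finset.Icc_subset_Icc (by omega) le_rfl) rfl
    (fun i hi => by
      simp only [Finset.mem_sdiff, Finset.mem_Icc] at hi
      rw [hve i (by omega), Nat.card_Icc, Nat.add_sub_cancel, ← hD]
      exact hC _ (heC i (by simp; omega))) hpack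
  exact hL'.isContained

end StarForest

/-! ### Counting cliques by weights. -/

namespace StarForest

variable {V : Type*} [Fintype V] [DecidableEq V]

/-- A complete subgraph is determined by its vertex set. -/
theorem copyCount_completeGraph_le (G : SimpleGraph V) [DecidableRel G.Adj] (r : ℕ) :
    G.copyCount (SimpleGraph.completeGraph (Fin r)) ≤ (G.cliqueFinset r).card := by
  classical
  have hS : ∀ S : G.Subgraph, Nonempty (SimpleGraph.completeGraph (Fin r) ≃g S.coe) →
      ∀ x y, S.Adj x y ↔ x ∈ S.verts ∧ y ∈ S.verts ∧ x ≠ y := by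
    rintro S ⟨f⟩ x y
    refine ⟨fun h => ⟨S.edge_vert h, S.edge_vert h.symm, h.ne⟩, fun ⟨hx, hy, hne⟩ => ?_⟩
    have := f.symm.map_adj_iff (v := ⟨x, hx⟩) (w := ⟨y, hy⟩)
    rw [SimpleGraph.Subgraph.coe_adj] at this
    exact this.1 ((SimpleGraph.top_adj _ _).2
      fun h => hne (congrArg Subtype.val (f.symm.injective h)))
  rw [SimpleGraph.copyCount]
  refine Finset.card_le_card_of_injOn (fun S => S.verts.toFinset) ?_ ?_
  · intro S hf
    replace hf := (Finset.mem_filter.1 (Finset.mem_coe.1 hf)).2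
    rw [Finset.mem_coe, SimpleGraph.mem_cliqueFinset_iff, SimpleGraph.isNClique_iff]
    refine ⟨fun x hx y hy hne => ?_, ?_⟩
    · rw [Set.coe_toFinset] at hx hy
      exact S.adj_sub ((hS S hf x y).2 ⟨hx, hy, hne⟩)
    · obtain ⟨f⟩ := hf
      rw [Set.toFinset_card, ← Fintype.card_congr f.toEquiv, Fintype.card_fin]
  · intro S hf T hg hST
    replace hf := (Finset.mem_filter.1 (Finset.mem_coe.1 hf)).2
    replace hg := (Finset.mem_filter.1 (Finset.mem_coe.1 hg)).2
    have hv : S.verts = T.verts := Set.toFinset_inj.1 hST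
    refine SimpleGraph.Subgraph.ext hv ?_
    ext x y
    rw [hS S hf, hS T hg, hv]

/-- Double counting of pairs `(s, x)` with `x ∈ s \ C`: given `x`, the clique is determined by `s ∩
C` and by the rest of `s \ C`, which consists of neighbours of `x`. -/
theorem mul_card_cliques_le (G : SimpleGraph V) [DecidableRel G.Adj] (C : Finset V) {r j : ℕ}
    (hj : j < r) :
    (r - j) * {s ∈ G.cliqueFinset r | (s ∩ C).card = j}.card ≤
      ∑ x ∈ Cᶜ, C.card.choose j * (outDegree G C x).choose (r - 1 - j) := by
  set Q := {s ∈ G.cliqueFinset r | (s ∩ C).card = j} with hQ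
  have hmem : ∀ s ∈ Q, G.IsClique s ∧ s.card = r ∧ (s ∩ C).card = j := by
    intro s hs
    rw [hQ, Finset.mem_filter, SimpleGraph.mem_cliqueFinset_iff, SimpleGraph.isNClique_iff] at hs
    exact ⟨hs.1.1, hs.1.2, hs.2⟩
  have hsd : ∀ s ∈ Q, (s \ C).card = r - j := by
    intro s hs
    have := Finset.card_sdiff_add_card_inter s C
    have := hmem s hs
    omega
  have hsum : (r - j) * Q.card = ∑ x ∈ Cᶜ, {s ∈ Q | x ∈ s}.card := by
    have := Finset.sum_card_bipartiteAbove_eq_sum_card_bipartiteBelow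
      (s := Q) (t := Cᶜ) (fun s x => x ∈ s)
    rw [← show ∑ x ∈ Cᶜ, (Finset.bipartiteBelow (fun s x => x ∈ s) Q x).card =
      ∑ x ∈ Cᶜ, {s ∈ Q | x ∈ s}.card from rfl, ← this, mul_comm, ← smul_eq_mul]
    refine (Finset.sum_const_nat fun s hs => ?_).symm
    rw [← hsd s hs]
    congr 1
    ext x
    simp [Finset.bipartiteAbove, and_comm]
  rw [hsum]
  refine Finset.sum_le_sum fun x hx => ?_
  rw [Finset.mem_compl] at hx
  have hcard : (C.powersetCard j ×ˢ (G.neighborFinset x \ C).powersetCard (r - 1 - j)).card =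
      C.card.choose j * (outDegree G C x).choose (r - 1 - j) := by
    rw [Finset.card_product, Finset.card_powersetCard, Finset.card_powersetCard, outDegree]
  rw [← hcard]
  refine Finset.card_le_card_of_injOn (fun s => (s ∩ C, (s \ C).erase x)) ?_ ?_
  · intro s hs
    obtain ⟨hs, hxs⟩ := Finset.mem_filter.1 (Finset.mem_coe.1 hs)
    have h := hmem s hs
    rw [Finset.mem_coe, Finset.mem_product, Finset.mem_powersetCard, Finset.mem_powersetCard]
    refine ⟨⟨Finset.inter_subset_right, h.2.2⟩, fun y hy => ?_, ?_⟩
    · rw [Finset.mem_erase, Finset.mem_sdiff] at hy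
      rw [Finset.mem_sdiff, SimpleGraph.mem_neighborFinset]
      exact ⟨h.1 hxs hy.2.1 hy.1.symm, hy.2.2⟩
    · rw [Finset.card_erase_of_mem (Finset.mem_sdiff.2 ⟨hxs, hx⟩), hsd s hs]
      omega
  · intro s hs t ht hst
    have hs := (Finset.mem_filter.1 (Finset.mem_coe.1 hs)).2
    have ht := (Finset.mem_filter.1 (Finset.mem_coe.1 ht)).2
    rw [Prod.mk.injEq] at hst
    have h2 : s \ C = t \ C := by
      rw [← Finset.insert_erase (Finset.mem_sdiff.2 ⟨hs, hx⟩), hst.2,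
        Finset.insert_erase (Finset.mem_sdiff.2 ⟨ht, hx⟩)]
    rw [← Finset.sdiff_union_inter s C, ← Finset.sdiff_union_inter t C, h2, hst.1]

/-- The number of `r`-cliques not contained in a set of `c` universal vertices that can be
attributed to a vertex with `y` further neighbours, each such clique being shared equally among
its vertices outside of that set. -/
noncomputable def cliqueWeight (c r y : ℕ) : ℝ :=
  ∑ j ∈ Finset.range r, ((c.choose j * y.choose (r - 1 - j) : ℕ) : ℝ) / ((r - j : ℕ) : ℝ)

theorem cliqueWeight_nonneg (c r y : ℕ) : 0 ≤ cliqueWeight c r y :=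
  Finset.sum_nonneg fun _ _ => by positivity

theorem cliqueWeight_mono (c r : ℕ) {y z : ℕ} (h : y ≤ z) :
    cliqueWeight c r y ≤ cliqueWeight c r z := by
  unfold cliqueWeight
  refine Finset.sum_le_sum fun j _ => ?_
  have := Nat.choose_le_choose (r - 1 - j) h
  gcongr

theorem cliqueWeight_lt_succ {c r y : ℕ} (hr : 2 ≤ r) (h : r ≤ y + c + 2) :
    cliqueWeight c r y < cliqueWeight (c + 1) r y := by
  unfold cliqueWeight
  -- `1 ≤ j ≤ c + 1` makes the first binomial grow strictly with `c`; `r - 1 - j ≤ y` keeps the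
  -- second nonzero.
  obtain ⟨j, hj1, hj2, hj3, hj4⟩ : ∃ j, 1 ≤ j ∧ j < r ∧ j ≤ c + 1 ∧ r - 1 - j ≤ y :=
    ⟨max 1 (r - 1 - y), by omega, by omega, by omega, by omega⟩
  have hchoose : ∀ j, c.choose j ≤ (c + 1).choose j := fun j => Nat.choose_le_choose j (by omega)
  refine Finset.sum_lt_sum (fun j _ => ?_) ⟨j, Finset.mem_range.2 hj2, ?_⟩
  · have := hchoose j
    gcongr
  · have hy := Nat.choose_pos hj4
    have hc : c.choose j < (c + 1).choose j := by
      obtain ⟨i, rfl⟩ : ∃ i, j = i + 1 := ⟨j - 1, by omega⟩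
      have := Nat.choose_pos (show i ≤ c by omega)
      rw [Nat.choose_succ_succ']
      omega
    have h0 : (0 : ℝ) < ((r - j : ℕ) : ℝ) := by exact_mod_cast Nat.sub_pos_of_lt hj2
    gcongr

theorem cliqueWeight_eq_zero {c r y : ℕ} (h : y + c + 1 < r) : cliqueWeight c r y = 0 := by
  refine Finset.sum_eq_zero fun j _ => ?_
  have : c.choose j * y.choose (r - 1 - j) = 0 := by
    by_cases hj : c < j
    · rw [Nat.choose_eq_zero_of_lt hj, zero_mul]
    · rw [Nat.choose_eq_zero_of_lt (show y < r - 1 - j by omega), mul_zero]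
  rw [this, Nat.cast_zero, zero_div]

/-- In a complete graph on `c + (y + 1)` vertices, the `y + 1` vertices outside a `c`-set share
equally all `r`-cliques not inside it. Formally this is Vandermonde, with the term `j = r` split
off. -/
theorem mul_cliqueWeight (c r y : ℕ) :
    ((y : ℝ) + 1) * cliqueWeight c r y = ((c + (y + 1)).choose r : ℝ) - (c.choose r : ℝ) := by
  rw [Nat.add_choose_eq, Finset.Nat.sum_antidiagonal_eq_sum_range_succ
    (fun i j => c.choose i * (y + 1).choose j), Finset.sum_range_succ, Nat.sub_self,
    Nat.choose_zero_right, mul_one, Nat.cast_add, add_sub_cancel_right, Nat.cast_sum,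
    cliqueWeight, Finset.mul_sum]
  refine Finset.sum_congr rfl fun j hj => ?_
  have hj := Finset.mem_range.1 hj
  obtain ⟨m, hm⟩ : ∃ m, r - j = m + 1 := ⟨r - j - 1, by omega⟩
  rw [show r - 1 - j = m by omega, hm]
  have h := Nat.add_one_mul_choose_eq y m
  have h' : ((y : ℝ) + 1) * (y.choose m : ℝ) = ((y + 1).choose (m + 1) : ℝ) * ((m : ℝ) + 1) := by
    exact_mod_cast h
  have h0 : ((m : ℝ) + 1) ≠ 0 := by positivity
  push_cast
  rw [← mul_div_assoc, div_eq_iff h0]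
  linear_combination (c.choose j : ℝ) * h'

theorem card_cliqueFinset_le (G : SimpleGraph V) [DecidableRel G.Adj] (C : Finset V) (r : ℕ) :
    ((G.cliqueFinset r).card : ℝ) ≤
      (C.card.choose r : ℝ) + ∑ x ∈ Cᶜ, cliqueWeight C.card r (outDegree G C x) := by
  have hmaps : ∀ s ∈ G.cliqueFinset r, (s ∩ C).card ∈ Finset.range (r + 1) := by
    intro s hs
    have := (SimpleGraph.mem_cliqueFinset_iff.1 hs).card_eq
    have := Finset.card_le_card (Finset.inter_subset_left (s₁ := s) (s₂ := C))
    rw [Finset.mem_range]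
    omega
  rw [Finset.card_eq_sum_card_fiberwise hmaps, Finset.sum_range_succ, Nat.cast_add, add_comm]
  refine add_le_add ?_ ?_
  · rw [← Finset.card_powersetCard]
    refine Nat.cast_le.2 (Finset.card_le_card fun s hs => ?_)
    obtain ⟨hs, hsC⟩ := Finset.mem_filter.1 hs
    have hr := (SimpleGraph.mem_cliqueFinset_iff.1 hs).card_eq
    have := Finset.eq_of_subset_of_card_le (Finset.inter_subset_left (s₁ := s) (s₂ := C))
      (by omega)
    exact Finset.mem_powersetCard.2 ⟨Finset.inter_eq_left.1 this, hr⟩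
  · unfold cliqueWeight
    rw [Finset.sum_comm, Nat.cast_sum]
    refine Finset.sum_le_sum fun j hj => ?_
    have hj := Finset.mem_range.1 hj
    have h0 : (0 : ℝ) < ((r - j : ℕ) : ℝ) := by exact_mod_cast Nat.sub_pos_of_lt hj
    rw [← Finset.sum_div, le_div_iff₀ h0, mul_comm]
    exact_mod_cast mul_card_cliques_le G C hj

end StarForest

/-! ### Comparison with the terms of the bound. -/

namespace StarForest

theorem le_cliqueTerm {d : ℕ → ℕ} {c y : ℕ} (hy : d (c + 1) = y + 1) (r n : ℕ) :
    (c.choose r : ℝ) + ((n : ℝ) - c) * cliqueWeight c r y ≤ cliqueTerm d r n (c + 1) := by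
  have hw := mul_cliqueWeight c r y
  have h0 := cliqueWeight_nonneg c r y
  have hy0 : (0 : ℝ) < (y : ℝ) + 1 := by positivity
  have hle := Int.le_ceil (((n : ℝ) - c) / ((y : ℝ) + 1))
  rw [div_le_iff₀ hy0] at hle
  rw [cliqueTerm, hy, show y + 1 + (c + 1) - 1 = c + (y + 1) by omega, Nat.add_sub_cancel, ← hw]
  push_cast
  rw [show (n : ℝ) - ((c : ℝ) + 1) + 1 = (n : ℝ) - c by ring]
  have := mul_le_mul_of_nonneg_right hle h0
  linarith

theorem eventually_linear_le {a b : ℝ} (hab : a < b) (β : ℝ) :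
    ∃ N : ℕ, ∀ n : ℕ, N ≤ n → a * n + β ≤ b * n := by
  obtain ⟨N, hN⟩ := exists_nat_ge (β / (b - a))
  refine ⟨N, fun n hn => ?_⟩
  have h1 : β / (b - a) ≤ n := hN.trans (Nat.cast_le.2 hn)
  rw [div_le_iff₀ (sub_pos.2 hab)] at h1
  linarith

theorem exists_term_eventually_ge {k : ℕ} (hk : 2 ≤ k) {d : ℕ → ℕ} (hd1 : 2 ≤ d 1) {r : ℕ}
    (hr : 2 ≤ r) {c y : ℕ} (hc : c + 2 ≤ k) (hy : d (c + 2) = y + 1) (β : ℝ) :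
    ∃ N : ℕ, ∀ n : ℕ, N ≤ n →
      cliqueWeight c r y * n + β ≤ (boundTerms k d r n).max' (boundTerms_nonempty hk d r n) := by
  by_cases h : r ≤ y + c + 2
  · obtain ⟨N, hN⟩ := eventually_linear_le (cliqueWeight_lt_succ hr h)
      (β + ((c : ℝ) + 1) * cliqueWeight (c + 1) r y)
    refine ⟨N, fun n hn => ?_⟩
    have hmem : cliqueTerm d r n (c + 1 + 1) ∈ boundTerms k d r n := by
      simp only [boundTerms, Finset.mem_union, Finset.mem_image]
      exact Or.inl (Or.inl ⟨c + 1 + 1, Finset.mem_Icc.2 ⟨by omega, hc⟩, rfl⟩)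
    refine le_trans ?_ (Finset.le_max' _ _ hmem)
    refine le_trans ?_ (le_cliqueTerm hy r n)
    have h1 := hN n hn
    have h2 : (0 : ℝ) ≤ ((c + 1).choose r : ℝ) := Nat.cast_nonneg _
    push_cast
    linarith
  -- Here the left side is constant in `n`, so any term of positive slope suffices.
  · rw [cliqueWeight_eq_zero (by omega)]
    have hpos : 0 < ((d 1 : ℝ) - 1) / r := by
      have : (2 : ℝ) ≤ d 1 := by exact_mod_cast hd1
      have : (2 : ℝ) ≤ r := by exact_mod_cast hr
      exact div_pos (by linarith) (by linarith)
    obtain ⟨N, hN⟩ := eventually_linear_le hpos β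
    refine ⟨N, fun n hn => ?_⟩
    have hmem : regularTerm d r n 1 ∈ boundTerms k d r n := by
      simp only [boundTerms, Finset.mem_union, Finset.mem_image]
      exact Or.inl (Or.inr ⟨1, Finset.mem_filter.2
        ⟨Finset.mem_Icc.2 ⟨le_rfl, by omega⟩, by omega⟩, rfl⟩)
    refine (hN n hn).trans ((Finset.le_max' _ _ hmem).trans' (le_of_eq ?_))
    simp [regularTerm]

/-- The at most `M` vertices of large outdegree contribute only a constant, because outdegrees are
bounded by `D`. -/
theorem sum_cliqueWeight_le {V : Type*} [Fintype V] [DecidableEq V] (G : SimpleGraph V)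
    [DecidableRel G.Adj] (C : Finset V) (c r y : ℕ) {D M : ℕ}
    (hD : ∀ x ∉ C, outDegree G C x ≤ D)
    (hM : {x ∈ Cᶜ | y + 1 ≤ outDegree G C x}.card ≤ M) :
    ∑ x ∈ Cᶜ, cliqueWeight c r (outDegree G C x) ≤
      cliqueWeight c r y * Fintype.card V + M * cliqueWeight c r D := by
  rw [← Finset.sum_filter_add_sum_filter_not _ (fun x => y + 1 ≤ outDegree G C x), add_comm]
  refine add_le_add ?_ ?_
  · refine (Finset.sum_le_card_nsmul _ _ (cliqueWeight c r y) fun x hx => ?_).trans ?_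
    · have := (Finset.mem_filter.1 hx).2
      exact cliqueWeight_mono c r (by omega)
    · rw [nsmul_eq_mul, mul_comm]
      exact mul_le_mul_of_nonneg_left (Nat.cast_le.2 (Finset.card_le_univ _))
        (cliqueWeight_nonneg c r y)
  · refine (Finset.sum_le_card_nsmul _ _ (cliqueWeight c r D) fun x hx => ?_).trans ?_
    · exact cliqueWeight_mono c r (hD x (Finset.mem_compl.1 (Finset.mem_filter.1 hx).1))
    · rw [nsmul_eq_mul]
      exact mul_le_mul_of_nonneg_right (Nat.cast_le.2 hM) (cliqueWeight_nonneg c r D)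

/-- The case `r = 1` is separate: `cliqueWeight c 1 y` equals 1 for every `c`, so the strict
comparison of slopes fails. -/
theorem card_cliqueFinset_one_le {k : ℕ} (hk : 2 ≤ k) {d : ℕ → ℕ} (hd1 : 2 ≤ d 1) {n : ℕ}
    (G : SimpleGraph (Fin n)) [DecidableRel G.Adj] :
    ((G.cliqueFinset 1).card : ℝ) ≤
      (boundTerms k d 1 n).max' (boundTerms_nonempty hk d 1 n) := by
  have hmem : cliqueTerm d 1 n (0 + 1) ∈ boundTerms k d 1 n := by
    simp only [boundTerms, Finset.mem_union, Finset.mem_image]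
    exact Or.inl (Or.inl ⟨1, Finset.mem_Icc.2 ⟨le_rfl, by omega⟩, rfl⟩)
  obtain ⟨y, hy⟩ : ∃ y, d (0 + 1) = y + 1 := ⟨d 1 - 1, by simp; omega⟩
  refine le_trans ?_ ((le_cliqueTerm hy 1 n).trans (Finset.le_max' _ _ hmem))
  have h := G.card_cliqueFinset_le (n := 1)
  rw [Nat.choose_one_right, Fintype.card_fin] at h
  simpa [cliqueWeight] using h

theorem card_cliqueFinset_le_max' {k : ℕ} (hk : 2 ≤ k) {d : ℕ → ℕ}
    (hd : ∀ i j : ℕ, 1 ≤ i → i ≤ j → j ≤ k → d j ≤ d i) (hdk : 2 ≤ d k) {r : ℕ} (hr : 2 ≤ r) :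
    ∃ n₀ : ℕ, ∀ n : ℕ, n₀ ≤ n → ∀ (G : SimpleGraph (Fin n)) [DecidableRel G.Adj],
      (starForest k d).Free G → ((G.cliqueFinset r).card : ℝ) ≤
        (boundTerms k d r n).max' (boundTerms_nonempty hk d r n) := by
  obtain ⟨D, hD⟩ : ∃ D, D = k + ∑ i ∈ Finset.Icc 1 k, d i := ⟨_, rfl⟩
  have hd2 : ∀ i, 1 ≤ i → i ≤ k → d i = d i - 1 + 1 := fun i h1 h2 => by
    have := hd i k h1 h2 le_rfl
    omega
  have hd1 : 2 ≤ d 1 := hdk.trans (hd 1 k le_rfl (by omega) le_rfl)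
  have hev : ∀ c, ∃ N : ℕ, c + 2 ≤ k → ∀ n : ℕ, N ≤ n →
      cliqueWeight c r (d (c + 2) - 1) * n + ((c.choose r : ℝ) +
        ((k * (1 + (D + D * D)) : ℕ) : ℝ) * cliqueWeight c r D) ≤
      (boundTerms k d r n).max' (boundTerms_nonempty hk d r n) := by
    intro c
    by_cases hc : c + 2 ≤ k
    · obtain ⟨N, hN⟩ := exists_term_eventually_ge hk hd1 hr hc (hd2 (c + 2) (by omega) hc)
        ((c.choose r : ℝ) + ((k * (1 + (D + D * D)) : ℕ) : ℝ) * cliqueWeight c r D)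
      exact ⟨N, fun _ => hN⟩
    · exact ⟨0, fun h => absurd h hc⟩
  choose N hN using hev
  -- The size of `C` depends on `G` but is below `k`, so one threshold serves all graphs.
  refine ⟨(Finset.range k).sup N, fun n hn G _ hG => ?_⟩
  obtain ⟨C, hC⟩ : ∃ C : Finset (Fin n), C = Finset.univ.filter (D ≤ G.degree ·) := ⟨_, rfl⟩
  have hCD : ∀ x ∈ C, D ≤ G.degree x := fun x hx => by simpa [hC] using hx
  have hCD' : ∀ x ∉ C, G.degree x < D := fun x hx => by simpa [hC] using hx
  have hck : C.card < k := card_lt_of_free (by omega) hG (hD ▸ hCD)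
  have hcount := card_cliqueFinset_le G C r
  by_cases hmax : ∃ x ∉ C, d (C.card + 1) ≤ outDegree G C x
  · obtain ⟨v₀, hv₀, hv₀d⟩ := hmax
    by_cases hX : C.card + 1 < k → k * (1 + (D + D * D)) <
        {x ∈ Cᶜ | d (C.card + 2) ≤ outDegree G C x}.card
    · exact absurd (isContained_of_outDegree hD hd hck hCD hCD' hv₀ hv₀d hX) hG
    · push Not at hX
      obtain ⟨hc, hX⟩ := hX
      have hc2 : C.card + 2 ≤ k := hc
      rw [hd2 (C.card + 2) (by omega) hc2] at hX
      have hsum := sum_cliqueWeight_le G C C.card r (d (C.card + 2) - 1)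
        (fun x hx => (outDegree_le_degree G C x).trans (hCD' x hx).le) hX
      have hfin := hN C.card hc2 n ((Finset.le_sup (Finset.mem_range.2 hck)).trans hn)
      rw [Fintype.card_fin] at hsum
      linarith
  · push Not at hmax
    have hmem : cliqueTerm d r n (C.card + 1) ∈ boundTerms k d r n := by
      simp only [boundTerms, Finset.mem_union, Finset.mem_image]
      exact Or.inl (Or.inl ⟨C.card + 1, Finset.mem_Icc.2 ⟨by omega, hck⟩, rfl⟩)
    refine le_trans ?_ (Finset.le_max' _ _ hmem)
    refine hcount.trans (le_trans ?_ (le_cliqueTerm (hd2 _ (by omega) hck) r n))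
    refine add_le_add le_rfl ((Finset.sum_le_card_nsmul _ _
      (cliqueWeight C.card r (d (C.card + 1) - 1)) fun x hx => ?_).trans_eq ?_)
    · have := hmax x (Finset.mem_compl.1 hx)
      exact cliqueWeight_mono _ r (by omega)
    · rw [nsmul_eq_mul, Finset.card_compl, Nat.cast_sub (Finset.card_le_univ C),
        Fintype.card_fin]

end StarForest

/-! ### Passage to the generalized Turán number. -/

theorem mainTheorem6 (k : ℕ) (hk : 2 ≤ k) (d : ℕ → ℕ)
    (hd : ∀ i j : ℕ, 1 ≤ i → i ≤ j → j ≤ k → d j ≤ d i) (hdk : 2 ≤ d k)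
    (r : ℕ) (hr : 1 ≤ r) (hrd : r ≤ d 1 + k - 2) :
    ∃ n₀ : ℕ, ∀ n : ℕ, n₀ ≤ n →
      (generalizedTuran n (SimpleGraph.completeGraph (Fin r)) (starForest k d) : ℝ) ≤
        (boundTerms k d r n).max' (boundTerms_nonempty hk d r n) := by
  classical
  have key : ∃ n₀ : ℕ, ∀ n : ℕ, n₀ ≤ n → ∀ G : SimpleGraph (Fin n),
      (starForest k d).Free G → ((G.cliqueFinset r).card : ℝ) ≤
        (boundTerms k d r n).max' (boundTerms_nonempty hk d r n) := by
    rcases hr.eq_or_lt with rfl | hr2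
    · exact ⟨0, fun n _ G _ => StarForest.card_cliqueFinset_one_le hk
        (hdk.trans (hd 1 k le_rfl (by omega) le_rfl)) G⟩
    · obtain ⟨n₀, h⟩ := StarForest.card_cliqueFinset_le_max' hk hd hdk hr2
      exact ⟨n₀, fun n hn G hG => h n hn G hG⟩
  obtain ⟨n₀, h⟩ := key
  refine ⟨n₀, fun n hn => ?_⟩
  -- The forest has an edge, so the empty graph is free and the supremum is attained.
  have hne : ({G : SimpleGraph (Fin n) | (starForest k d).Free G} :
      Finset (SimpleGraph (Fin n))).Nonempty := by
    refine ⟨⊥, Finset.mem_filter.2 ⟨Finset.mem_univ _, ?_⟩⟩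
    rintro ⟨f⟩
    have h1 : 1 ∈ Finset.Icc 1 k := Finset.mem_Icc.2 ⟨le_rfl, by omega⟩
    have hd1 : 2 ≤ d 1 := hdk.trans (hd 1 k le_rfl (by omega) le_rfl)
    have hadj : (starForest k d).Adj ⟨⟨1, h1⟩, 0⟩ ⟨⟨1, h1⟩, Fin.last (d 1)⟩ := by
      rw [starForest, SimpleGraph.iSup_adj]
      refine ⟨⟨1, h1⟩, (SimpleGraph.map_adj _ _ _ _).2 ⟨0, Fin.last _, ?_, rfl, rfl⟩⟩
      refine SimpleGraph.starGraph_center_adj fun h => ?_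
      have := congrArg Fin.val h
      simp at this
      omega
    exact f.toHom.map_adj hadj
  obtain ⟨G, hG, hGmax⟩ := Finset.exists_mem_eq_sup _ hne
    (fun G => G.copyCount (SimpleGraph.completeGraph (Fin r)))
  rw [generalizedTuran, hGmax]
  exact (Nat.cast_le.2 (StarForest.copyCount_completeGraph_le G r)).trans
    (h n hn G (Finset.mem_filter.1 hG).2)
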